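/- Call the points of the plane $\mathbb R^2$ with integer coordinates lattice points. Let $M=A_1A_2\dots A_n$ ($n\ge 3$) be a convex polygon, with consecutive vertices $A_1,\dots,A_n$, all of which are lattice points, and suppose that the interior of $M$ contains exactly one lattice point $O$. Put $A_{n+1}=A_1$. For $i=1,\dots,n$ lay off the side vector $\overrightarrow{A_iA_{i+1}}$ from $O$, and let $B_i$ be the lattice point different from $O$ that is nearest to $O$ on the segment from $O$ to $O+\overrightarrow{A_iA_{i+1}}$. The dual polygon $M^*=B_1B_2\dots B_n$ is obtained by joining the points $B_1,B_2,\dots,B_n,B_1$ consecutively by segments. Let $m$ and $m^*$ be the numbers of lattice points on the boundaries of $M$ and of $M^*$ respectively (the boundary being the union of the sides). Then $$m+m^*=12.$$ -/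

import Mathlib

/-- The plane with a fixed Cartesian coordinate system. -/
abbrev Plane : Type := EuclideanSpace ℝ (Fin 2)

/-- The lattice points of the plane: the points both of whose coordinates are integers. -/
def latticePoints : Set Plane := {x | ∀ c : Fin 2, ∃ k : ℤ, x c = (k : ℝ)}

namespace Polygon

/-- `M 0, M 1, …, M (n - 1)` are the consecutive vertices of a convex polygon: there are at least
three of them, consecutive ones are distinct, and for every side, all the vertices other than its
two endpoints lie strictly on one and the same side of the line through it.
(The successor of the vertex number `i` in the cyclic order is the vertex number `finRotate n i`.) -/
structure IsConvex {n : ℕ} (M : Polygon Plane n) : Prop where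
  three_le : 3 ≤ n
  nondegenerate : M.HasNondegenerateEdges
  sameSide : ∀ i j k : Fin n, j ≠ i → j ≠ finRotate n i → k ≠ i → k ≠ finRotate n i →
    (line[ℝ, M i, M (finRotate n i)]).SSameSide (M j) (M k)

/-- All vertices are lattice points. -/
def IsLattice {n : ℕ} (M : Polygon Plane n) : Prop :=
  ∀ i, M i ∈ latticePoints

/-- The points strictly inside the convex polygon `M`. -/
def inside {n : ℕ} (M : Polygon Plane n) : Set Plane :=
  interior (convexHull ℝ (Set.range M.vertices))

/-- The lattice points on the boundary of a polygon (the union of its sides). -/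
def boundaryLatticePoints {n : ℕ} (M : Polygon Plane n) : Set Plane :=
  M.boundary ℝ ∩ latticePoints

end Polygon

/-- `B` is a lattice point different from `O` on the vector `v` laid off from `O` (that is, on the
segment from `O` to `v +ᵥ O`), and it is the nearest to `O` among all such points. -/
structure IsNearestLatticePoint (O v B : Plane) : Prop where
  mem_segment : B ∈ affineSegment ℝ O (v +ᵥ O)
  mem_lattice : B ∈ latticePoints
  ne : B ≠ O
  dist_le : ∀ C ∈ affineSegment ℝ O (v +ᵥ O), C ∈ latticePoints → C ≠ O → dist O B ≤ dist O C

/-- `N` is the dual polygon of `M` with respect to `O`: its `i`-th vertex is the lattice point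
nearest to `O` on the `i`-th side vector of `M` laid off from `O`. -/
def Polygon.IsDual {n : ℕ} (M : Polygon Plane n) (O : Plane) (N : Polygon Plane n) : Prop :=
  ∀ i : Fin n, IsNearestLatticePoint O (M (finRotate n i) -ᵥ M i) (N i)

theorem mem_affineSegment_vadd_iff {O v B : Plane} :
    B ∈ affineSegment ℝ O (v +ᵥ O) ↔ ∃ t : ℝ, 0 ≤ t ∧ t ≤ 1 ∧ B = t • v + O := by
  simp only [affineSegment, Set.mem_image, Set.mem_Icc, AffineMap.lineMap_apply, vadd_eq_add]
  constructor
  · rintro ⟨t, ⟨h0, h1⟩, rfl⟩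
    exact ⟨t, h0, h1, by simp⟩
  · rintro ⟨t, h0, h1, rfl⟩
    exact ⟨t, ⟨h0, h1⟩, by simp⟩

/-- The nearest lattice point exists and is unique. -/
theorem existsUnique_isNearestLatticePoint {O v : Plane} (hO : O ∈ latticePoints)
    (hv : v +ᵥ O ∈ latticePoints) (hv0 : v ≠ 0) : ∃! B, IsNearestLatticePoint O v B := by
  have hc : ∃ c, v c ≠ 0 := by
    by_contra! h
    exact hv0 (by ext c; simpa using h c)
  obtain ⟨c, hc⟩ := hc
  have hvn : 0 < ‖v‖ := norm_pos_iff.mpr hv0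
  have hd : ∀ t : ℝ, 0 ≤ t → dist O (t • v + O) = t * ‖v‖ := fun t ht => by
    rw [dist_comm, dist_eq_norm, add_sub_cancel_right, norm_smul, Real.norm_of_nonneg ht]
  let S : Set Plane := {B | B ∈ affineSegment ℝ O (v +ᵥ O) ∧ B ∈ latticePoints ∧ B ≠ O}
  have hS : S.Nonempty := by
    refine ⟨v +ᵥ O, mem_affineSegment_vadd_iff.mpr ⟨1, by simp, le_rfl, by simp⟩, hv, ?_⟩
    simpa using hv0
  let f : Plane → ℕ := fun B => ⌊|B c - O c|⌋₊
  have hf : ∀ B ∈ S, (f B : ℝ) = |B c - O c| := by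
    rintro B ⟨-, hB, -⟩
    obtain ⟨k, hk⟩ := hB c
    obtain ⟨l, hl⟩ := hO c
    have : |B c - O c| = ((k - l).natAbs : ℝ) := by
      rw [hk, hl, Nat.cast_natAbs]; push_cast; rfl
    simp only [f, this, Nat.floor_natCast]
  obtain ⟨B, hBS, hmin⟩ : ∃ B ∈ S, ∀ C ∈ S, f B ≤ f C := by
    obtain ⟨B, hB, h⟩ := (measure f).wf.has_min S hS
    exact ⟨B, hB, fun C hC => not_lt.mp (h C hC)⟩
  have hfc : ∀ t : ℝ, 0 ≤ t → |(t • v + O) c - O c| = t * |v c| := fun t ht => by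
    simp [abs_mul, abs_of_nonneg ht]
  have hB : IsNearestLatticePoint O v B := by
    refine ⟨hBS.1, hBS.2.1, hBS.2.2, fun C h1 h2 h3 => ?_⟩
    have hle : (f B : ℝ) ≤ f C := by exact_mod_cast hmin C ⟨h1, h2, h3⟩
    rw [hf B hBS, hf C ⟨h1, h2, h3⟩] at hle
    obtain ⟨t, ht, -, rfl⟩ := mem_affineSegment_vadd_iff.mp hBS.1
    obtain ⟨s, hs, -, rfl⟩ := mem_affineSegment_vadd_iff.mp h1
    rw [hfc t ht, hfc s hs] at hle
    rw [hd t ht, hd s hs]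
    have := le_of_mul_le_mul_right hle (abs_pos.mpr hc)
    gcongr
  refine ⟨B, hB, fun C hC => ?_⟩
  have h1 := le_antisymm (hC.dist_le B hB.mem_segment hB.mem_lattice hB.ne)
    (hB.dist_le C hC.mem_segment hC.mem_lattice hC.ne)
  obtain ⟨t, ht, -, rfl⟩ := mem_affineSegment_vadd_iff.mp hB.mem_segment
  obtain ⟨s, hs, -, rfl⟩ := mem_affineSegment_vadd_iff.mp hC.mem_segment
  rw [hd t ht, hd s hs] at h1
  rw [mul_right_cancel₀ hvn.ne' h1]

/-- A lattice polygon with nondegenerate sides has exactly one dual polygon with respect to each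
lattice point. -/
theorem Polygon.existsUnique_isDual {n : ℕ} {M : Polygon Plane n} {O : Plane}
    (hM : M.IsLattice) (hne : M.HasNondegenerateEdges) (hO : O ∈ latticePoints) :
    ∃! N, M.IsDual O N := by
  have key : ∀ i, ∃! B, IsNearestLatticePoint O (M (finRotate n i) -ᵥ M i) B := fun i => by
    refine existsUnique_isNearestLatticePoint hO (fun c => ?_)
      (vsub_ne_zero.mpr (hne i).symm)
    obtain ⟨a, ha⟩ := hM (finRotate n i) c
    obtain ⟨b, hb⟩ := hM i c
    obtain ⟨o, ho⟩ := hO c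
    refine ⟨a - b + o, ?_⟩
    simp only [vsub_eq_sub, vadd_eq_add, PiLp.add_apply, PiLp.sub_apply, ha, hb, ho]
    push_cast
    rfl
  choose B hB hu using key
  refine ⟨⟨B⟩, hB, ?_⟩
  rintro ⟨C⟩ hC
  congr 1
  funext i
  exact hu i _ (hC i)

/-! Take `O` as origin and traverse `M` counterclockwise. Let v_i be the vertices, u_i the primitive
side vectors and m_i the lattice lengths of the sides. The triangle O A_i A_{i+1} has no lattice
point but `O` off its side A_i A_{i+1}, which forces det(v_i, u_i) = 1
(`cross_eq_one_of_empty_triangle`). Since u_i and u_{i+1} both have determinant 1 with v_{i+1},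
u_{i+1} = u_i - a_i v_{i+1}. Thus the dual polygon, with vertices u_i, is of the same kind with side
lengths a_i (`exists_dual`), and m + m* is the sum of all m_i + a_i.

The matrices with columns v_i, u_i lie in SL₂(ℤ). Passing to the next one adds the second column to
the first m_i times, then subtracts the first from the second a_i times. The steps add, subtract,
add turn (a, b) into (b, -a), a quarter turn, so a full revolution is worth twelve steps. The
potential `rademacher` makes this exact: it gains 1 at each step and loses 12 when the bottom row
crosses a fixed ray. Around the closed polygon its change is zero, so m + m* is 12 times the number
of crossings. Convexity allows at most one crossing (`eq_of_crossing`), and positivity of the sum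
excludes none. -/

/-! ### The potential on SL₂(ℤ) -/

/-- An integer-valued potential on `SL₂(ℤ)`, written for the matrix with rows `(a, b)` and `(c, d)`
and computed by the Euclidean algorithm on the bottom row. It grows by one under each of the
elementary column operations `rademacher_add_col` and `rademacher_sub_col`, except for a jump
by `-12` when the bottom row crosses the ray `c = 0 < d`. -/
def rademacher (a b c d : ℤ) : ℤ :=
  -- The constants 0, 3, 6, 9 belong to the four half-axes taken clockwise from `c = 0 < d`. On
  -- each, the elementary step fixing the bottom row changes `a` or `b` by one, whence the linear
  -- terms.
  if hd : d = 0 then (if 0 < c then 3 - a else 9 + a)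
  else if hc : c = 0 then (if 0 < d then -b else 6 + b)
  else if h : d.natAbs < c.natAbs then
    (if hs : 0 < c ↔ 0 < d then rademacher (a - b) b (c - d) d + 1
      else rademacher (a + b) b (c + d) d - 1)
  else
    (if hs : 0 < c ↔ 0 < d then rademacher a (b - a) c (d - c) - 1
      else rademacher a (b + a) c (d + c) + 1)
termination_by c.natAbs + d.natAbs

theorem rademacher_zero_right_of_pos {a b c : ℤ} (hc : 0 < c) : rademacher a b c 0 = 3 - a := by
  rw [rademacher]; simp [hc]

theorem rademacher_zero_right_of_neg {a b c : ℤ} (hc : c < 0) : rademacher a b c 0 = 9 + a := by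
  rw [rademacher]; simp [hc.le]

theorem rademacher_zero_left_of_pos {a b d : ℤ} (hd : 0 < d) : rademacher a b 0 d = -b := by
  rw [rademacher]; simp [hd, hd.ne']

theorem rademacher_zero_left_of_neg {a b d : ℤ} (hd : d < 0) : rademacher a b 0 d = 6 + b := by
  rw [rademacher]; simp [hd.le, hd.ne]

theorem rademacher_of_lt_of_same_sign {a b c d : ℤ} (h : d.natAbs < c.natAbs) (hd : d ≠ 0)
    (hs : 0 < c ↔ 0 < d) : rademacher a b c d = rademacher (a - b) b (c - d) d + 1 := by
  have hc : c ≠ 0 := by omega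
  rw [rademacher]; simp [hc, hd, h, hs]

theorem rademacher_of_lt_of_opp_sign {a b c d : ℤ} (h : d.natAbs < c.natAbs) (hd : d ≠ 0)
    (hs : ¬(0 < c ↔ 0 < d)) : rademacher a b c d = rademacher (a + b) b (c + d) d - 1 := by
  have hc : c ≠ 0 := by omega
  rw [rademacher]; simp only [hc, hd, h, hs, dite_true, dite_false]

theorem rademacher_of_le_of_same_sign {a b c d : ℤ} (h : c.natAbs ≤ d.natAbs) (hc : c ≠ 0)
    (hs : 0 < c ↔ 0 < d) : rademacher a b c d = rademacher a (b - a) c (d - c) - 1 := by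
  have hd : d ≠ 0 := by omega
  rw [rademacher]; simp [hc, hd, h.not_gt, hs]

theorem rademacher_of_le_of_opp_sign {a b c d : ℤ} (h : c.natAbs ≤ d.natAbs) (hc : c ≠ 0)
    (hs : ¬(0 < c ↔ 0 < d)) : rademacher a b c d = rademacher a (b + a) c (d + c) + 1 := by
  have hd : d ≠ 0 := by omega
  rw [rademacher]; simp only [hc, hd, h.not_gt, hs, dite_false]

/-- The potential grows by three under a clockwise quarter turn of the bottom row. -/
theorem rademacher_rotate {a b c d : ℤ} (hdet : a * d - b * c = 1) :
    rademacher b (-a) d (-c) = rademacher a b c d + 3 - if c < 0 ∧ 0 ≤ d then 12 else 0 := by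
  induction hN : c.natAbs + d.natAbs using Nat.strong_induction_on generalizing a b c d with
  | _ N ih =>
  subst hN
  rcases eq_or_ne d 0 with rfl | hd
  · rcases lt_trichotomy c 0 with hc | rfl | hc
    · rw [rademacher_zero_left_of_pos (by omega), rademacher_zero_right_of_neg hc]
      simp [hc]; ring
    · simp at hdet
    · rw [rademacher_zero_left_of_neg (by omega), rademacher_zero_right_of_pos hc]
      simp [hc.not_gt]; ring
  rcases eq_or_ne c 0 with rfl | hc
  · rcases lt_or_gt_of_ne hd with hd | hd
    · rw [neg_zero, rademacher_zero_right_of_neg hd, rademacher_zero_left_of_neg hd]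
      simp; ring
    · rw [neg_zero, rademacher_zero_right_of_pos hd, rademacher_zero_left_of_pos hd]
      simp; ring
  rcases lt_trichotomy d.natAbs c.natAbs with h | h | h
  -- The quarter turn exchanges the two Euclidean branches, so reduction commutes with it and the
  -- unit corrections cancel.
  · by_cases hs : 0 < c ↔ 0 < d
    · rw [rademacher_of_lt_of_same_sign h hd hs,
        rademacher_of_le_of_opp_sign (by omega) hd (by omega)]
      have := ih _ (by omega) (a := a - b) (b := b) (c := c - d) (d := d) (by linarith) rfl
      rw [show -a + b = -(a - b) by ring, show -c + d = -(c - d) by ring, this]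
      split_ifs <;> omega
    · rw [rademacher_of_lt_of_opp_sign h hd hs,
        rademacher_of_le_of_same_sign (by omega) hd (by omega)]
      have := ih _ (by omega) (a := a + b) (b := b) (c := c + d) (d := d) (by linarith) rfl
      rw [show -a - b = -(a + b) by ring, show -c - d = -(c + d) by ring, this]
      split_ifs <;> omega
  -- On a tie the matrix and its turn take the same branch, so induction does not apply; but
  -- determinant one forces the bottom entries to be ±1.
  · rcases Int.natAbs_eq_natAbs_iff.mp h with rfl | rfl
    · have hu : d ∣ 1 := ⟨a - b, by linarith⟩
      rw [rademacher_of_le_of_same_sign le_rfl hd Iff.rfl,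
        rademacher_of_le_of_opp_sign (by omega) hd (by omega)]
      rcases Int.isUnit_iff.mp (isUnit_of_dvd_one hu) with rfl | rfl
      · norm_num [rademacher_zero_right_of_pos]; omega
      · norm_num [rademacher_zero_right_of_neg]; omega
    · have hu : c ∣ 1 := ⟨-a - b, by linarith⟩
      rw [rademacher_of_le_of_opp_sign (by omega) hc (by omega),
        rademacher_of_le_of_same_sign (by omega) hd (by omega)]
      rcases Int.isUnit_iff.mp (isUnit_of_dvd_one hu) with rfl | rfl
      · norm_num [rademacher_zero_right_of_pos, rademacher_zero_right_of_neg]; omega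
      · norm_num [rademacher_zero_right_of_pos, rademacher_zero_right_of_neg]; omega
  · by_cases hs : 0 < c ↔ 0 < d
    · rw [rademacher_of_le_of_same_sign h.le hc hs,
        rademacher_of_lt_of_opp_sign (by omega) (by omega) (by omega)]
      have := ih _ (by omega) (a := a) (b := b - a) (c := c) (d := d - c) (by linarith) rfl
      rw [← sub_eq_add_neg, ← sub_eq_add_neg, this]
      split_ifs <;> omega
    · rw [rademacher_of_le_of_opp_sign h.le hc hs,
        rademacher_of_lt_of_same_sign (by omega) (by omega) (by omega)]
      have := ih _ (by omega) (a := a) (b := b + a) (c := c) (d := d + c) (by linarith) rfl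
      rw [sub_neg_eq_add, sub_neg_eq_add, this]
      split_ifs <;> omega

/-- Subtracting the first column from the second raises the potential by one. -/
theorem rademacher_sub_col {a b c d : ℤ} (hdet : a * d - b * c = 1) :
    rademacher a (b - a) c (d - c) = rademacher a b c d + 1 := by
  rcases eq_or_ne c 0 with rfl | hc
  · have hu : d ∣ 1 := ⟨a, by linarith⟩
    rcases Int.isUnit_iff.mp (isUnit_of_dvd_one hu) with rfl | rfl
    · norm_num [rademacher_zero_left_of_pos]; omega
    · norm_num [rademacher_zero_left_of_neg]; omega
  -- In this case and the next, one recursive call undoes the column operation.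
  by_cases h1 : d = 0 ∨ ¬(0 < c ↔ 0 < d)
  · rw [rademacher_of_le_of_opp_sign (d := d - c) (by omega) hc (by omega)]
    simp
  by_cases h2 : c.natAbs ≤ d.natAbs
  · rw [rademacher_of_le_of_same_sign h2 hc (by omega)]
    simp
  -- Here both sides reduce to matrices differing by a quarter turn with no crossing; its gain of 3
  -- balances the unit corrections.
  rw [rademacher_of_lt_of_same_sign (c := c) (d := d) (by omega) (by omega) (by omega),
    rademacher_of_lt_of_opp_sign (d := d - c) (by omega) (by omega) (by omega)]
  have := rademacher_rotate (a := a - b) (b := b) (c := c - d) (d := d) (by linarith)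
  rw [show a + (b - a) = b by ring, show b - a = -(a - b) by ring,
    show c + (d - c) = d by ring, show d - c = -(c - d) by ring, this]
  split_ifs <;> omega

/-- Adding the second column to the first raises the potential by one, unless the bottom row
crosses the ray `c = 0 < d`. -/
theorem rademacher_add_col {a b c d : ℤ} (hdet : a * d - b * c = 1) :
    rademacher (a + b) b (c + d) d
      = rademacher a b c d + 1 - if c < 0 ∧ 0 ≤ c + d then 12 else 0 := by
  -- The quarter turn conjugates this operation into the column subtraction.
  have h1 := rademacher_rotate (a := a + b) (b := b) (c := c + d) (d := d) (by linarith)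
  have h2 := rademacher_rotate hdet
  have h3 := rademacher_sub_col (a := b) (b := -a) (c := d) (d := -c) (by linarith)
  rw [show -a - b = -(a + b) by ring, show -c - d = -(c + d) by ring] at h3
  split_ifs at * <;> omega

theorem rademacher_sub_mul_col {a b c d : ℤ} (hdet : a * d - b * c = 1) (k : ℕ) :
    rademacher a (b - k * a) c (d - k * c) = rademacher a b c d + k := by
  induction k with
  | zero => simp
  | succ k ih =>
    have := rademacher_sub_col (a := a) (b := b - k * a) (c := c) (d := d - k * c) (by linarith)
    push_cast
    rw [show b - (k + 1) * a = b - k * a - a by ring,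
      show d - (k + 1) * c = d - k * c - c by ring, this, ih]
    ring

theorem rademacher_add_mul_col {a b c d : ℤ} (hdet : a * d - b * c = 1) (k : ℕ) :
    rademacher (a + k * b) b (c + k * d) d
      = rademacher a b c d + k - if c < 0 ∧ 0 ≤ c + k * d then 12 else 0 := by
  induction k with
  | zero => simp; omega
  | succ k ih =>
    have := rademacher_add_col (a := a + k * b) (b := b) (c := c + k * d) (d := d) (by linarith)
    push_cast
    rw [show a + (k + 1) * b = a + k * b + b by ring,
      show c + (k + 1) * d = c + k * d + d by ring, this, ih]
    -- `c + k * d` is monotone in `k`, so the jump occurs at most once.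
    rcases lt_or_ge 0 d with hd | hd
    · have : 0 ≤ k * d := by positivity
      split_ifs <;> omega
    · have : k * d ≤ 0 := mul_nonpos_of_nonneg_of_nonpos (by positivity) hd
      split_ifs <;> omega

/-! ### Cyclic successors -/

theorem finRotate_ne_self {n : ℕ} (hn : 2 ≤ n) (i : Fin n) : finRotate n i ≠ i := by
  obtain ⟨n, rfl⟩ : ∃ k, n = k + 1 := ⟨n - 1, by omega⟩
  intro h
  have := congrArg Fin.val h
  rw [coe_finRotate] at this
  split_ifs at this with h
  · subst h; simp at this; omega
  · omega

theorem finRotate_finRotate_ne_self {n : ℕ} (hn : 3 ≤ n) (i : Fin n) :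
    finRotate n (finRotate n i) ≠ i := by
  obtain ⟨n, rfl⟩ : ∃ k, n = k + 1 := ⟨n - 1, by omega⟩
  intro h
  have := congrArg Fin.val h
  simp only [coe_finRotate, Fin.ext_iff, Fin.val_last] at this
  split_ifs at this <;> omega

/-! ### Reflexive polygons, their duals and the sum 12 -/

/-- The determinant of two integer vectors. -/
def cross (p q : ℤ × ℤ) : ℤ := p.1 * q.2 - p.2 * q.1

/-- The closed sequence of integer vectors `v i` is, in counterclockwise order, the sequence of
vertices of a convex polygon each of whose sides lies at lattice distance one from the origin:
the primitive direction vector of the `i`-th side is `u i` and its lattice length is `m i`. -/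
structure IsReflexive {n : ℕ} (v u : Fin n → ℤ × ℤ) (m : Fin n → ℕ) : Prop where
  three_le : 3 ≤ n
  pos : ∀ i, 0 < m i
  succ : ∀ i, v (finRotate n i) = v i + (m i : ℤ) • u i
  cross_le : ∀ i j, cross (v j) (u i) ≤ 1
  cross_eq_iff : ∀ i j, cross (v j) (u i) = 1 ↔ j = i ∨ j = finRotate n i

namespace IsReflexive

variable {n : ℕ} {v u : Fin n → ℤ × ℤ} {m : Fin n → ℕ}

theorem cross_self (h : IsReflexive v u m) (i : Fin n) : cross (v i) (u i) = 1 :=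
  (h.cross_eq_iff i i).2 (Or.inl rfl)

theorem cross_finRotate (h : IsReflexive v u m) (i : Fin n) :
    cross (v (finRotate n i)) (u i) = 1 :=
  (h.cross_eq_iff i _).2 (Or.inr rfl)

/-- Two distinct indices succeeding each other would form a cycle of length two, impossible for `3 ≤
n`. -/
theorem eq_of_adjacent (h : IsReflexive v u m) {i j : Fin n} (h1 : j = i ∨ j = finRotate n i)
    (h2 : i = j ∨ i = finRotate n j) : i = j := by
  rcases h1 with h1 | h1
  · exact h1.symm
  rcases h2 with h2 | h2
  · exact h2
  · subst h1
    exact absurd h2.symm (finRotate_finRotate_ne_self h.three_le i)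

/-- The primitive side vectors of a reflexive polygon are the vertices of a reflexive polygon. -/
theorem exists_dual (h : IsReflexive v u m) :
    ∃ a : Fin n → ℕ, IsReflexive u (fun i => -v (finRotate n i)) a := by
  have hneg : ∀ p q : ℤ × ℤ, cross p (-q) = cross q p := fun p q => by simp [cross]; ring
  have hcr : ∀ i, ∃ a : ℕ, 0 < a ∧ u (finRotate n i) = u i + (a : ℤ) • -v (finRotate n i) := by
    intro i
    set x := v (finRotate n i) with hx
    have h1 : cross x (u i) = 1 := h.cross_finRotate i
    have h2 : cross x (u (finRotate n i)) = 1 := h.cross_self _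
    have h3 : cross (v i) (u (finRotate n i)) < 1 := by
      refine lt_of_le_of_ne (h.cross_le _ _) fun he => ?_
      rcases (h.cross_eq_iff _ _).1 he with he | he
      · exact finRotate_ne_self (by have := h.three_le; omega) i he.symm
      · exact finRotate_finRotate_ne_self h.three_le i he.symm
    set a := cross (u i) (u (finRotate n i)) with ha
    -- Both side vectors have determinant 1 with `x`, so their difference is a multiple of `x`.
    have hu : u (finRotate n i) = u i + a • -x := by
      simp only [cross] at h1 h2 ha
      ext
      · simp [ha, -finRotate_apply]; linear_combination (u i).1 * h2 - (u (finRotate n i)).1 * h1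
      · simp [ha, -finRotate_apply]; linear_combination (u i).2 * h2 - (u (finRotate n i)).2 * h1
    have hpos : 0 < a := by
      -- The right side is the lattice distance of `v i` from the line of the next side, positive
      -- because `v i` is not on that side.
      have h4 : (m i : ℤ) * a = 1 - cross (v i) (u (finRotate n i)) := by
        have hs := h.succ i
        rw [← hx] at hs
        rw [hs] at h2
        simp only [cross, Prod.fst_add, Prod.snd_add, Prod.smul_fst, Prod.smul_snd,
          smul_eq_mul] at h2 ha ⊢
        rw [ha]
        linear_combination h2
      by_contra! hle
      have := mul_nonpos_of_nonneg_of_nonpos (Int.natCast_nonneg (m i)) hle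
      omega
    lift a to ℕ using hpos.le with k
    exact ⟨k, by exact_mod_cast hpos, hu⟩
  choose a ha hsucc using hcr
  refine ⟨a, h.three_le, ha, hsucc, fun i j => ?_, fun i j => ?_⟩
  · rw [hneg]; exact h.cross_le _ _
  · rw [hneg, h.cross_eq_iff, (finRotate n).injective.eq_iff, or_comm, @eq_comm _ i j,
      @eq_comm _ (finRotate n i) j]

/-- A reflexive polygon crosses the positive half of the first coordinate axis at most once. -/
theorem eq_of_crossing (h : IsReflexive v u m) {i j : Fin n}
    (hi : (v i).2 < 0 ∧ 0 ≤ (v (finRotate n i)).2)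
    (hj : (v j).2 < 0 ∧ 0 ≤ (v (finRotate n j)).2) : i = j := by
  have hu : ∀ i, (v (finRotate n i)).2 - (v i).2 = m i * (u i).2 := fun i => by
    rw [h.succ]; simp
  have hm : ∀ i, (0 : ℤ) < m i := fun i => by exact_mod_cast h.pos i
  -- Weighting the ends of side `j` so that the second coordinate cancels gives `(m j, 0)`, a
  -- positive multiple of the point where the side meets the axis.
  have key : ∀ i j, (v j).2 < 0 → 0 ≤ (v (finRotate n j)).2 →
      (v (finRotate n j)).2 * cross (v j) (u i) - (v j).2 * cross (v (finRotate n j)) (u i)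
        = m j * (u i).2 := by
    intro i j _ _
    have h1 := h.cross_self j
    rw [h.succ]
    simp only [cross, Prod.fst_add, Prod.snd_add, Prod.smul_fst, Prod.smul_snd, smul_eq_mul] at *
    linear_combination m j * (u i).2 * h1
  have hle : ∀ i j, (v j).2 < 0 → 0 ≤ (v (finRotate n j)).2 → (u i).2 ≤ (u j).2 := by
    intro i j h1 h2
    have h3 := key i j h1 h2
    have h4 := mul_le_mul_of_nonneg_left (h.cross_le i j) h2
    have h5 := mul_le_mul_of_nonneg_left (h.cross_le i (finRotate n j)) (neg_nonneg.2 h1.le)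
    refine le_of_mul_le_mul_left ?_ (hm j)
    linarith [hu j]
  -- The weight of the far end `v (finRotate n j)` is `-(v j).2 > 0`, so equality puts that end on
  -- side `i`.
  have hadj : ∀ i j, (v j).2 < 0 → 0 ≤ (v (finRotate n j)).2 → (u i).2 = (u j).2 →
      finRotate n j = i ∨ finRotate n j = finRotate n i := by
    intro i j h1 h2 he
    have h3 := key i j h1 h2
    have h4 := mul_le_mul_of_nonneg_left (h.cross_le i j) h2
    have h5 := h.cross_le i (finRotate n j)
    refine (h.cross_eq_iff _ _).1 (le_antisymm h5 ?_)
    have h6 := hu j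
    rw [← he] at h6
    refine le_of_mul_le_mul_left ?_ (neg_pos.2 h1)
    linarith
  have he := le_antisymm (hle i j hj.1 hj.2) (hle j i hi.1 hi.2)
  rcases hadj i j hj.1 hj.2 he with h1 | h1
  · rcases hadj j i hi.1 hi.2 he.symm with h2 | h2
    · subst h1
      exact absurd h2 (finRotate_finRotate_ne_self h.three_le j)
    · exact (finRotate n).injective h2
  · exact (finRotate n).injective h1.symm

/-- The lattice lengths of the boundaries of a reflexive polygon and of its dual add up to 12. -/
theorem sum_add_sum_dual (h : IsReflexive v u m) {a : Fin n → ℕ}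
    (hd : IsReflexive u (fun i => -v (finRotate n i)) a) : ∑ i, m i + ∑ i, a i = 12 := by
  let φ : Fin n → ℤ := fun i => rademacher (v i).1 (u i).1 (v i).2 (u i).2
  let s : Finset (Fin n) := {i | (v i).2 < 0 ∧ 0 ≤ (v (finRotate n i)).2}
  have hstep : ∀ i, φ (finRotate n i)
      = φ i + m i + a i - if (v i).2 < 0 ∧ 0 ≤ (v (finRotate n i)).2 then 12 else 0 := by
    intro i
    have h1 := h.cross_self i
    have h2 := h.cross_finRotate i
    have hv := h.succ i
    have hu := hd.succ i
    simp only [cross] at h1 h2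
    have h3 := rademacher_add_mul_col (a := (v i).1) (b := (u i).1) (c := (v i).2) (d := (u i).2)
      (by linarith) (m i)
    have h4 := rademacher_sub_mul_col (a := (v (finRotate n i)).1) (b := (u i).1)
      (c := (v (finRotate n i)).2) (d := (u i).2) (by linarith) (a i)
    have e1 : (v (finRotate n i)).1 = (v i).1 + m i * (u i).1 := by rw [hv]; simp
    have e2 : (v (finRotate n i)).2 = (v i).2 + m i * (u i).2 := by rw [hv]; simp
    have e3 : (u (finRotate n i)).1 = (u i).1 - a i * (v (finRotate n i)).1 := by
      rw [hu]; simp; ring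
    have e4 : (u (finRotate n i)).2 = (u i).2 - a i * (v (finRotate n i)).2 := by
      rw [hu]; simp; ring
    rw [← e1, ← e2] at h3
    rw [← e3, ← e4, h3] at h4
    simp only [φ, h4]
    ring
  have hsum : (∑ i, (m i : ℤ)) + ∑ i, (a i : ℤ) = 12 * s.card := by
    have h1 : ∑ i, φ (finRotate n i) = ∑ i, φ i := Equiv.sum_comp _ _
    simp only [hstep, Finset.sum_sub_distrib, Finset.sum_add_distrib] at h1
    rw [← Finset.sum_filter, Finset.sum_const, nsmul_eq_mul] at h1
    simp only [s]
    linarith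
  have hle : s.card ≤ 1 := Finset.card_le_one.2 fun i hi j hj =>
    h.eq_of_crossing (by simpa [s] using hi) (by simpa [s] using hj)
  have hpos : 0 < ∑ i, m i := by
    have : 0 < n := by have := h.three_le; omega
    exact Finset.sum_pos (fun i _ => h.pos i) ⟨⟨0, this⟩, Finset.mem_univ _⟩
  have : (∑ i, m i) + ∑ i, a i = 12 * s.card := by exact_mod_cast hsum
  omega

end IsReflexive

/-! ### Integer coordinates and lattice points on sides -/

/-- The lattice point with coordinates `p` with respect to the origin `O` and the coordinate
vectors `(1, 0)` and `(0, s)`. -/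
noncomputable def toPlane (O : Plane) (s : ℤ) (p : ℤ × ℤ) : Plane :=
  !₂[O 0 + p.1, O 1 + s * p.2]

@[simp] theorem toPlane_zero (O : Plane) (s : ℤ) (p : ℤ × ℤ) : toPlane O s p 0 = O 0 + p.1 := by
  simp [toPlane]

@[simp] theorem toPlane_one (O : Plane) (s : ℤ) (p : ℤ × ℤ) :
    toPlane O s p 1 = O 1 + s * p.2 := by
  simp [toPlane]

theorem Plane.ext {x y : Plane} (h0 : x 0 = y 0) (h1 : x 1 = y 1) : x = y := by
  ext c
  fin_cases c
  · exact h0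
  · exact h1

theorem toPlane_injective (O : Plane) {s : ℤ} (hs : s * s = 1) :
    Function.Injective (toPlane O s) := by
  intro p q h
  have h0 := congrArg (fun x : Plane => x 0) h
  have h1 := congrArg (fun x : Plane => x 1) h
  have hs0 : (s : ℝ) ≠ 0 := by
    have : s ≠ 0 := by rintro rfl; simp at hs
    exact_mod_cast this
  simp only [toPlane_zero, toPlane_one, add_right_inj, mul_right_inj' hs0, Int.cast_inj] at h0 h1
  exact Prod.ext h0 h1

theorem toPlane_mem_latticePoints {O : Plane} (hO : O ∈ latticePoints) (s : ℤ) (p : ℤ × ℤ) :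
    toPlane O s p ∈ latticePoints := by
  obtain ⟨a, ha⟩ := hO 0
  obtain ⟨b, hb⟩ := hO 1
  intro c
  fin_cases c
  · exact ⟨a + p.1, by simp [ha]⟩
  · exact ⟨b + s * p.2, by simp [hb]⟩

theorem exists_eq_toPlane {O x : Plane} (hO : O ∈ latticePoints) (hx : x ∈ latticePoints)
    {s : ℤ} (hs : s * s = 1) : ∃ p, x = toPlane O s p := by
  obtain ⟨a, ha⟩ := hO 0
  obtain ⟨b, hb⟩ := hO 1
  obtain ⟨c, hc⟩ := hx 0
  obtain ⟨d, hd⟩ := hx 1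
  have hs' : (s : ℝ) * s = 1 := by exact_mod_cast hs
  refine ⟨(c - a, s * (d - b)), Plane.ext ?_ ?_⟩
  · simp [ha, hc]
  · simp only [toPlane_one, hb, hd]
    push_cast
    linear_combination -(d - b : ℝ) * hs'

/-- An integer vector parallel to a primitive vector is an integer multiple of it. -/
theorem eq_zsmul_of_cross_eq_zero {v u w : ℤ × ℤ} (hvu : cross v u = 1) (hw : cross w u = 0) :
    w = cross v w • u := by
  simp only [cross] at *
  ext
  · simp only [Prod.smul_fst, smul_eq_mul]
    linear_combination (-w.1) * hvu + v.1 * hw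
  · simp only [Prod.smul_snd, smul_eq_mul]
    linear_combination (-w.2) * hvu + v.2 * hw

/-- The vector `w` witnesses that `u` is primitive: `cross w (k • u) = k`, so pairing with `w` shows
that the parameter of a lattice point is an integer. -/
theorem toPlane_mem_affineSegment_iff {O : Plane} {s : ℤ} (hs : s * s = 1) {p w u z : ℤ × ℤ}
    (hwu : cross w u = 1) (m : ℕ) :
    toPlane O s z ∈ affineSegment ℝ (toPlane O s p) (toPlane O s (p + (m : ℤ) • u)) ↔
      ∃ k : ℕ, k ≤ m ∧ z = p + (k : ℤ) • u := by
  have hs0 : (s : ℝ) ≠ 0 := by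
    have : s ≠ 0 := by rintro rfl; simp at hs
    exact_mod_cast this
  constructor
  · rintro ⟨t, ⟨ht0, ht1⟩, ht⟩
    have e0 := congrArg (fun x : Plane => x 0) ht
    have e1 := congrArg (fun x : Plane => x 1) ht
    simp only [AffineMap.lineMap_apply, vsub_eq_sub, vadd_eq_add, PiLp.add_apply, PiLp.smul_apply,
      PiLp.sub_apply, toPlane_zero, toPlane_one, Prod.fst_add, Prod.snd_add, Prod.smul_fst,
      Prod.smul_snd, smul_eq_mul] at e0 e1
    push_cast at e0 e1
    have e0' : (z.1 : ℝ) = p.1 + t * m * u.1 := by linarith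
    have e1' : (z.2 : ℝ) = p.2 + t * m * u.2 := by
      refine mul_left_cancel₀ hs0 ?_
      linarith
    have hcr : (w.1 : ℝ) * u.2 - w.2 * u.1 = 1 := by exact_mod_cast hwu
    have hz : cross (z - p) u = 0 := by
      have : ((cross (z - p) u : ℤ) : ℝ) = 0 := by
        simp only [cross, Prod.fst_sub, Prod.snd_sub]
        push_cast
        rw [e0', e1']; ring
      exact_mod_cast this
    have hk : ((cross w (z - p) : ℤ) : ℝ) = t * m := by
      simp only [cross, Prod.fst_sub, Prod.snd_sub]
      push_cast
      rw [e0', e1']; linear_combination t * m * hcr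
    have hk0 : 0 ≤ cross w (z - p) := by
      have : (0 : ℝ) ≤ t * m := by positivity
      rw [← hk] at this; exact_mod_cast this
    have hkm : cross w (z - p) ≤ m := by
      have : t * m ≤ (m : ℝ) := mul_le_of_le_one_left (by positivity) ht1
      rw [← hk] at this; exact_mod_cast this
    have hzk := eq_zsmul_of_cross_eq_zero hwu hz
    generalize cross w (z - p) = k at *
    lift k to ℕ using hk0
    exact ⟨k, by exact_mod_cast hkm, by rw [← hzk]; abel⟩
  · rintro ⟨k, hk, rfl⟩
    rcases Nat.eq_zero_or_pos m with rfl | hm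
    · obtain rfl : k = 0 := by omega
      simp
    have hm' : (0 : ℝ) < m := by exact_mod_cast hm
    refine ⟨k / m, ⟨by positivity, (div_le_one hm').2 (by exact_mod_cast hk)⟩, Plane.ext ?_ ?_⟩
    · simp only [AffineMap.lineMap_apply, vsub_eq_sub, vadd_eq_add, PiLp.add_apply,
        PiLp.smul_apply, PiLp.sub_apply, toPlane_zero, Prod.fst_add, Prod.smul_fst, smul_eq_mul]
      push_cast
      field_simp
      ring
    · simp only [AffineMap.lineMap_apply, vsub_eq_sub, vadd_eq_add, PiLp.add_apply,
        PiLp.smul_apply, PiLp.sub_apply, toPlane_one, Prod.snd_add, Prod.smul_snd, smul_eq_mul]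
      push_cast
      field_simp
      ring

namespace IsReflexive

variable {n : ℕ} {v u : Fin n → ℤ × ℤ} {m : Fin n → ℕ}

/-- A common point has determinant 1 with `u i` and carries positive weight at `v j`, since `l < m
j`. Hence `v j` lies on side `i`; by symmetry `v i` lies on side `j`. -/
theorem eq_of_side_point_eq (h : IsReflexive v u m) {i j : Fin n} {k l : ℕ} (hk : k < m i)
    (hl : l < m j) (he : v i + (k : ℤ) • u i = v j + (l : ℤ) • u j) : i = j := by
  have key : ∀ i j : Fin n, ∀ k l : ℕ, l < m j → v i + (k : ℤ) • u i = v j + (l : ℤ) • u j →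
      j = i ∨ j = finRotate n i := by
    intro i j k l hl he
    have h1 := h.cross_self i
    have h2 : cross (v i + (k : ℤ) • u i) (u i) = 1 := by
      simp only [cross, Prod.fst_add, Prod.snd_add, Prod.smul_fst, Prod.smul_snd,
        smul_eq_mul] at h1 ⊢
      linear_combination h1
    rw [he] at h2
    have h3 : (m j - l : ℤ) * cross (v j) (u i) + l * cross (v (finRotate n j)) (u i) = m j := by
      rw [h.succ j]
      simp only [cross, Prod.fst_add, Prod.snd_add, Prod.smul_fst, Prod.smul_snd,
        smul_eq_mul] at h2 ⊢
      linear_combination m j * h2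
    refine (h.cross_eq_iff _ _).1 (le_antisymm (h.cross_le _ _) ?_)
    have h4 := mul_le_mul_of_nonneg_left (h.cross_le i (finRotate n j)) (Int.natCast_nonneg l)
    have h5 : (0 : ℤ) < m j - l := by omega
    refine le_of_mul_le_mul_left ?_ h5
    linarith
  exact h.eq_of_adjacent (key i j k l hl he) (key j i l k hk he.symm)

/-- The number of lattice points on the boundary of a reflexive polygon is the lattice length of
the boundary. -/
theorem encard_boundaryLatticePoints (h : IsReflexive v u m) {O : Plane} (hO : O ∈ latticePoints)
    {s : ℤ} (hs : s * s = 1) {P : Polygon Plane n} (hP : ∀ i, P i = toPlane O s (v i)) :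
    P.boundaryLatticePoints.encard = (∑ i, m i : ℕ) := by
  -- Sides are taken without their final endpoint, so each vertex is counted once.
  let F : (Σ i : Fin n, Fin (m i)) → Plane :=
    fun x => toPlane O s (v x.1 + ((x.2 : ℕ) : ℤ) • u x.1)
  have hedge : ∀ i z, toPlane O s z ∈ P.edgeSet ℝ i ↔
      ∃ k : ℕ, k ≤ m i ∧ z = v i + (k : ℤ) • u i := fun i z => by
    rw [Polygon.edgeSet, hP, hP, h.succ]
    exact toPlane_mem_affineSegment_iff hs (h.cross_self i) _
  have hrange : P.boundaryLatticePoints = Set.range F := by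
    ext x
    simp only [Polygon.boundaryLatticePoints, Polygon.boundary, Set.mem_inter_iff, Set.mem_iUnion,
      Set.mem_range]
    constructor
    · rintro ⟨⟨i, hi⟩, hx⟩
      obtain ⟨z, rfl⟩ := exists_eq_toPlane hO hx hs
      obtain ⟨k, hk, rfl⟩ := (hedge i z).1 hi
      rcases hk.lt_or_eq with hk | rfl
      · exact ⟨⟨i, k, hk⟩, rfl⟩
      · refine ⟨⟨finRotate n i, 0, h.pos _⟩, ?_⟩
        simp only [F, Nat.cast_zero, zero_smul, add_zero, h.succ i]
    · rintro ⟨⟨i, k, hk⟩, rfl⟩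
      exact ⟨⟨i, (hedge i _).2 ⟨k, hk.le, rfl⟩⟩, toPlane_mem_latticePoints hO _ _⟩
  have hinj : Function.Injective F := by
    rintro ⟨i, k, hk⟩ ⟨j, l, hl⟩ he
    have he' := toPlane_injective O hs he
    simp only at he'
    obtain rfl := h.eq_of_side_point_eq hk hl he'
    have h1 := h.cross_self i
    have h2 := congrArg (cross (v i)) he'
    obtain rfl : k = l := by
      simp only [cross, Prod.fst_add, Prod.snd_add, Prod.smul_fst, Prod.smul_snd,
        smul_eq_mul] at h1 h2
      have : (k : ℤ) = l := by linear_combination h2 - (k - l : ℤ) * h1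
      exact_mod_cast this
    rfl
  rw [hrange, ← Set.image_univ, hinj.encard_image, Set.encard_univ, ENat.card_eq_coe_fintype_card]
  simp

end IsReflexive

/-! ### Signed areas, sides of a line and interior points -/

/-- Twice the signed area of the triangle `P Q x`. -/
def side (P Q x : Plane) : ℝ := (Q 0 - P 0) * (x 1 - P 1) - (Q 1 - P 1) * (x 0 - P 0)

theorem side_toPlane (O : Plane) (s : ℤ) (p q x : ℤ × ℤ) :
    side (toPlane O s p) (toPlane O s q) (toPlane O s x) = s * cross (q - p) (x - p) := by
  simp only [side, toPlane_zero, toPlane_one, cross, Prod.fst_sub, Prod.snd_sub]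
  push_cast
  ring

theorem side_eq_zero_of_mem {P Q x : Plane} (h : x ∈ line[ℝ, P, Q]) : side P Q x = 0 := by
  obtain ⟨t, rfl⟩ := mem_affineSpan_pair_iff_exists_lineMap_eq.1 h
  simp [side, AffineMap.lineMap_apply]
  ring

theorem mem_of_side_eq_zero {P Q x : Plane} (hPQ : P ≠ Q) (h : side P Q x = 0) :
    x ∈ line[ℝ, P, Q] := by
  refine mem_affineSpan_pair_iff_exists_lineMap_eq.2 ?_
  have hd : (Q 0 - P 0) ^ 2 + (Q 1 - P 1) ^ 2 ≠ 0 := by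
    intro h0
    refine hPQ (Plane.ext ?_ ?_) <;> nlinarith [sq_nonneg (Q 0 - P 0), sq_nonneg (Q 1 - P 1)]
  simp only [side] at h
  -- The parameter of the orthogonal projection of `x` onto the line.
  refine ⟨((Q 0 - P 0) * (x 0 - P 0) + (Q 1 - P 1) * (x 1 - P 1))
    / ((Q 0 - P 0) ^ 2 + (Q 1 - P 1) ^ 2), Plane.ext ?_ ?_⟩
  · simp only [AffineMap.lineMap_apply, vsub_eq_sub, vadd_eq_add, PiLp.add_apply,
      PiLp.smul_apply, PiLp.sub_apply, smul_eq_mul]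
    field_simp
    linear_combination (Q 1 - P 1) * h
  · simp only [AffineMap.lineMap_apply, vsub_eq_sub, vadd_eq_add, PiLp.add_apply,
      PiLp.smul_apply, PiLp.sub_apply, smul_eq_mul]
    field_simp
    linear_combination (-(Q 0 - P 0)) * h

theorem side_mul_side_pos_of_sSameSide {P Q x y : Plane} (hPQ : P ≠ Q)
    (h : (line[ℝ, P, Q]).SSameSide x y) : 0 < side P Q x * side P Q y := by
  obtain ⟨⟨p₁, hp₁, p₂, hp₂, hr⟩, hx, hy⟩ := h
  have hx0 : side P Q x ≠ 0 := fun h0 => hx (mem_of_side_eq_zero hPQ h0)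
  have hy0 : side P Q y ≠ 0 := fun h0 => hy (mem_of_side_eq_zero hPQ h0)
  have h1 := side_eq_zero_of_mem hp₁
  have h2 := side_eq_zero_of_mem hp₂
  rcases hr with hr | hr | ⟨r₁, r₂, hr₁, hr₂, hr⟩
  · exact absurd (by rwa [vsub_eq_zero_iff_eq.1 hr]) hx
  · exact absurd (by rwa [vsub_eq_zero_iff_eq.1 hr]) hy
  · have e0 := congrArg (fun x : Plane => x 0) hr
    have e1 := congrArg (fun x : Plane => x 1) hr
    simp only [vsub_eq_sub, PiLp.smul_apply, PiLp.sub_apply, smul_eq_mul] at e0 e1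
    have he : r₁ * side P Q x = r₂ * side P Q y := by
      simp only [side] at h1 h2 ⊢
      linear_combination (Q 0 - P 0) * e1 - (Q 1 - P 1) * e0 + r₁ * h1 - r₂ * h2
    have h3 : 0 < r₂ * (side P Q x * side P Q y) := by
      have : r₂ * (side P Q x * side P Q y) = r₁ * side P Q x ^ 2 := by
        linear_combination -(side P Q x) * he
      rw [this]; positivity
    exact pos_of_mul_pos_right h3 hr₂.le

theorem side_combo {P Q x y : Plane} {a b : ℝ} (hab : a + b = 1) :
    side P Q (a • x + b • y) = a * side P Q x + b * side P Q y := by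
  obtain rfl : b = 1 - a := by linarith
  simp [side]
  ring

/-- A signed area that is nonnegative on a set, and positive at some point, is positive in
the interior of the convex hull. -/
theorem side_pos_of_mem_interior {P Q O : Plane} {S : Set Plane} {ε : ℝ}
    (hS : ∀ x ∈ S, 0 ≤ ε * side P Q x) {y : Plane} (hy0 : 0 < ε * side P Q y)
    (hO : O ∈ interior (convexHull ℝ S)) : 0 < ε * side P Q O := by
  have hhull : convexHull ℝ S ⊆ {x | 0 ≤ ε * side P Q x} := by
    refine convexHull_min hS fun x hx z hz a b ha hb hab => ?_
    simp only [Set.mem_ofPred_eq] at *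
    rw [side_combo hab]
    have := mul_nonneg ha hx
    have := mul_nonneg hb hz
    linarith
  -- Moving `O` slightly away from `y` stays in the hull, where the form is nonnegative; this forces
  -- it to be positive at `O`.
  have hcont : Filter.Tendsto (fun t : ℝ => (1 + t) • O + (-t) • y) (nhdsWithin 0 (Set.Ioi 0))
      (nhds O) := by
    have : Continuous (fun t : ℝ => (1 + t) • O + (-t) • y) := by fun_prop
    have := (this.tendsto 0).mono_left (nhdsWithin_le_nhds (s := Set.Ioi 0))
    simpa using this
  obtain ⟨t, ht, ht0⟩ := ((hcont.eventually (mem_interior_iff_mem_nhds.1 hO)).and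
    self_mem_nhdsWithin).exists
  have h1 := hhull ht
  simp only [Set.mem_ofPred_eq] at h1
  rw [side_combo (by ring)] at h1
  have h2 : 0 < t * (ε * side P Q y) := mul_pos ht0 hy0
  have h3 : 0 < (1 + t) * (ε * side P Q O) := by linarith
  exact pos_of_mul_pos_right h3 (by linarith)

/-! ### Primitive vectors and empty triangles -/

theorem exists_cross_eq_one {v : ℤ × ℤ} (h : Int.gcd v.1 v.2 = 1) : ∃ w, cross v w = 1 := by
  have := Int.gcd_eq_gcd_ab v.1 v.2
  rw [h] at this
  exact ⟨(-Int.gcdB v.1 v.2, Int.gcdA v.1 v.2), by simp only [cross]; push_cast at this; linarith⟩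

theorem exists_eq_nsmul_primitive {v : ℤ × ℤ} (hv : v ≠ 0) :
    ∃ (g : ℕ) (u : ℤ × ℤ), 0 < g ∧ v = (g : ℤ) • u ∧ Int.gcd u.1 u.2 = 1 := by
  have hg : 0 < Int.gcd v.1 v.2 := by
    rw [Int.gcd_pos_iff]
    by_contra! h
    exact hv (Prod.ext h.1 h.2)
  obtain ⟨a, b, hab, ha, hb⟩ := Int.exists_gcd_one hg
  refine ⟨Int.gcd v.1 v.2, (a, b), hg, ?_, hab⟩
  ext
  · simpa [mul_comm] using ha
  · simpa [mul_comm] using hb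

/-- If the triangle with vertices `0`, `v`, `v + g • u` has no lattice points besides `0` off the
side opposite to `0`, then this side is at lattice distance one from `0`. -/
theorem cross_eq_one_of_empty_triangle {v u : ℤ × ℤ} {g : ℕ} (hg : 0 < g) (hpos : 0 < cross v u)
    (hu : Int.gcd u.1 u.2 = 1)
    (hempty : ∀ (z : ℤ × ℤ) (α β : ℝ), 0 ≤ α → 0 ≤ β → α + β < 1 →
      (z.1 : ℝ) = α * v.1 + β * (v + (g : ℤ) • u).1 →
      (z.2 : ℝ) = α * v.2 + β * (v + (g : ℤ) • u).2 → z = 0) : cross v u = 1 := by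
  have hv0 : v ≠ 0 := by rintro rfl; simp [cross] at hpos
  obtain ⟨k, v', hk, hv, hv'⟩ := exists_eq_nsmul_primitive hv0
  have hk1 : k = 1 := by
    by_contra hne
    have hk' : (1 : ℝ) < k := by exact_mod_cast (by omega : 1 < k)
    have h0 := hempty v' (1 / k) 0 (by positivity) le_rfl
      (by rw [add_zero, div_lt_one (by positivity)]; exact hk')
      (by rw [hv]; simp; field_simp) (by rw [hv]; simp; field_simp)
    rw [hv, h0] at hv0
    simp at hv0
  obtain ⟨w, hw⟩ := exists_cross_eq_one (v := v) (by
    rw [hv, hk1]; simpa using hv')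
  by_contra hne
  set D := cross v u with hD
  have hD2 : 2 ≤ D := by omega
  -- Adding multiples of `v` to `w` keeps `cross v z = 1` and brings `cross z u` into `[0, D)`.
  obtain ⟨t, ht⟩ : ∃ t : ℤ, t = -(cross w u / D) := ⟨_, rfl⟩
  obtain ⟨z, hz⟩ : ∃ z, z = w + t • v := ⟨_, rfl⟩
  have hvz : cross v z = 1 := by
    rw [hz]
    simp only [cross, Prod.fst_add, Prod.snd_add, Prod.smul_fst, Prod.smul_snd,
      smul_eq_mul] at hw ⊢
    linear_combination hw
  have hzu : cross z u = cross w u % D := by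
    have := Int.emod_add_mul_ediv (cross w u) D
    have h2 : cross z u = cross w u + t * D := by
      rw [hz, hD]
      simp only [cross, Prod.fst_add, Prod.snd_add, Prod.smul_fst, Prod.smul_snd, smul_eq_mul]
      ring
    rw [h2, ht]
    linarith
  have hF0 : 0 ≤ cross z u := by rw [hzu]; exact Int.emod_nonneg _ (by omega)
  have hFD : cross z u < D := by rw [hzu]; exact Int.emod_lt_of_pos _ (by omega)
  have e1 : D * z.1 = cross z u * v.1 + u.1 := by
    simp only [cross] at hvz hD ⊢
    rw [hD]
    linear_combination u.1 * hvz
  have e2 : D * z.2 = cross z u * v.2 + u.2 := by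
    simp only [cross] at hvz hD ⊢
    rw [hD]
    linear_combination u.2 * hvz
  rcases hF0.lt_or_eq with hF | hF
  · have hg' : (1 : ℝ) ≤ g := by exact_mod_cast hg
    have hg0 : (0 : ℝ) < g := by linarith
    have hD' : (0 : ℝ) < D := by exact_mod_cast hpos
    have hF' : (1 : ℝ) ≤ (cross z u : ℤ) := by exact_mod_cast hF
    have hFD' : ((cross z u : ℤ) : ℝ) < D := by exact_mod_cast hFD
    have e1' : (D : ℝ) * z.1 = (cross z u : ℤ) * v.1 + u.1 := by exact_mod_cast e1
    have e2' : (D : ℝ) * z.2 = (cross z u : ℤ) * v.2 + u.2 := by exact_mod_cast e2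
    -- These weights come from `D • z = cross z u • v + u` on writing `u` as `((v + g • u) - v) /
    -- g`. They are nonnegative as `cross z u ≥ 1 ≥ 1 / g`, and add up to `cross z u / D < 1`.
    have hz0 := hempty z (((cross z u : ℤ) - 1 / g) / D) (1 / (g * D)) ?_ (by positivity) ?_ ?_ ?_
    · rw [hz0] at hvz
      simp [cross] at hvz
    · have : (1 : ℝ) / g ≤ 1 := by rw [div_le_one hg0]; exact hg'
      exact div_nonneg (by linarith) hD'.le
    · have : (((cross z u : ℤ) : ℝ) - 1 / g) / D + 1 / (g * D) = (cross z u : ℤ) / D := by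
        field_simp; ring
      rw [this, div_lt_one hD']
      exact hFD'
    · simp only [Prod.fst_add, Prod.smul_fst, smul_eq_mul]
      push_cast
      field_simp
      linear_combination g * e1'
    · simp only [Prod.snd_add, Prod.smul_snd, smul_eq_mul]
      push_cast
      field_simp
      linear_combination g * e2'
  -- Now `u = D • z` with `D ≥ 2`, so `u` is not primitive.
  · rw [← hF] at e1 e2
    have h1 : D ∣ u.1 := ⟨z.1, by linarith⟩
    have h2 : D ∣ u.2 := ⟨z.2, by linarith⟩
    have h3 := Int.dvd_coe_gcd h1 h2
    rw [hu] at h3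
    have := Int.le_of_dvd one_pos h3
    omega

/-! ### From convex lattice polygons to reflexive ones -/

theorem finRotate_induction {n : ℕ} {p : Fin n → Prop} {i₀ : Fin n} (h0 : p i₀)
    (hs : ∀ i, p i → p (finRotate n i)) (i : Fin n) : p i := by
  obtain ⟨n, rfl⟩ : ∃ k, n = k + 1 := ⟨n - 1, by have := i.pos; omega⟩
  have hup : ∀ a b : ℕ, ∀ (ha : a < n + 1) (hb : b < n + 1), a ≤ b → p ⟨a, ha⟩ → p ⟨b, hb⟩ := by
    intro a b ha hb hab hpa
    induction b, hab using Nat.le_induction with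
    | base => exact hpa
    | succ b hab ih =>
      have := hs _ (ih (by omega))
      rwa [finRotate_of_lt (by omega)] at this
  have hlast : p ⟨n, by omega⟩ := hup i₀ n i₀.2 _ (by have := i₀.2; omega) h0
  have hzero : p ⟨0, by omega⟩ := by
    have := hs _ hlast
    rwa [finRotate_last'] at this
  exact hup 0 i _ i.2 (Nat.zero_le _) hzero

/-- A convex lattice polygon around the lattice point `O` can be described by integer coordinates
in which it is traversed counterclockwise. -/
theorem Polygon.IsConvex.exists_orientation {n : ℕ} {M : Polygon Plane n} (hconv : M.IsConvex)
    (hlat : M.IsLattice) {O : Plane} (hOl : O ∈ latticePoints) (hOi : O ∈ M.inside) :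
    ∃ (s : ℤ) (v : Fin n → ℤ × ℤ), s * s = 1 ∧ (∀ i, M i = toPlane O s (v i)) ∧
      (∀ i, 0 < cross (v i) (v (finRotate n i))) ∧
      ∀ i j, j ≠ i → j ≠ finRotate n i → 0 < cross (v (finRotate n i) - v i) (v j - v i) := by
  have hn := hconv.three_le
  choose r hr using fun i => exists_eq_toPlane hOl (hlat i) (s := 1) (by norm_num)
  have hO : O = toPlane O 1 0 := Plane.ext (by simp) (by simp)
  have hnext : ∀ i, finRotate n (finRotate n i) ≠ i ∧
      finRotate n (finRotate n i) ≠ finRotate n i := fun i =>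
    ⟨finRotate_finRotate_ne_self hn i, finRotate_ne_self (by omega) _⟩
  set e : Fin n → Fin n → ℤ := fun i j => cross (r (finRotate n i) - r i) (r j - r i) with he
  set δ : Fin n → ℤ := fun i => cross (r i) (r (finRotate n i)) with hδ
  have hside : ∀ i j, side (M i) (M (finRotate n i)) (M j) = e i j := fun i j => by
    rw [hr, hr, hr, side_toPlane]; simp [he, -finRotate_apply]
  have hsideO : ∀ i, side (M i) (M (finRotate n i)) O = δ i := fun i => by
    have : side (M i) (M (finRotate n i)) O = side (M i) (M (finRotate n i)) (toPlane O 1 0) := by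
      rw [← hO]
    rw [this, hr, hr, side_toPlane]
    simp only [hδ, cross, Prod.fst_sub, Prod.snd_sub, Prod.fst_zero, Prod.snd_zero]
    push_cast
    ring
  have he0 : ∀ i j k, j ≠ i → j ≠ finRotate n i → k ≠ i → k ≠ finRotate n i →
      0 < e i j * e i k := by
    intro i j k h1 h2 h3 h4
    have := side_mul_side_pos_of_sSameSide (hconv.nondegenerate i)
      (hconv.sameSide i j k h1 h2 h3 h4)
    rw [hside, hside] at this
    exact_mod_cast this
  have hends : ∀ i j, j = i ∨ j = finRotate n i → e i j = 0 := by
    rintro i j (rfl | rfl)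
    · simp [he, cross]
    · simp [he, cross, -finRotate_apply]; ring
  have hδe : ∀ i j, j ≠ i → j ≠ finRotate n i → 0 < δ i * e i j := by
    intro i j h1 h2
    have := side_pos_of_mem_interior (P := M i) (Q := M (finRotate n i)) (O := O)
      (S := Set.range M.vertices) (ε := e i j) (y := M j) ?_ ?_ hOi
    · rw [hsideO] at this
      rw [mul_comm]
      exact_mod_cast this
    · rintro _ ⟨k, rfl⟩
      rw [hside]
      by_cases hk : k = i ∨ k = finRotate n i
      · simp [hends i k hk]
      · push Not at hk
        exact_mod_cast (he0 i j k h1 h2 hk.1 hk.2).le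
    · rw [hside]
      exact_mod_cast he0 i j j h1 h2 h1 h2
  have hδδ : ∀ i, 0 < δ i * δ (finRotate n i) := by
    intro i
    have h1 := hδe i _ (hnext i).1 (hnext i).2
    have h2 := hδe (finRotate n i) i (finRotate_ne_self (by omega) i).symm (hnext i).1.symm
    -- Both are twice the signed area of the triangle on three consecutive vertices, so `δ` keeps
    -- its sign from one side to the next.
    have h3 : e (finRotate n i) i = e i (finRotate n (finRotate n i)) := by
      simp only [he, cross, Prod.fst_sub, Prod.snd_sub]; ring
    rw [h3] at h2
    have h4 := mul_pos h1 h2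
    set x := e i (finRotate n (finRotate n i))
    have h5 : 0 < (δ i * δ (finRotate n i)) * (x * x) := by linarith
    exact pos_of_mul_pos_left h5 (mul_self_nonneg x)
  obtain ⟨s, hs, hsδ⟩ : ∃ s : ℤ, s * s = 1 ∧ ∀ i, 0 < s * δ i := by
    have h0 : 0 < δ ⟨0, by omega⟩ * δ (finRotate n ⟨0, by omega⟩) := hδδ _
    have hne : δ ⟨0, by omega⟩ ≠ 0 := fun h => by rw [h] at h0; simp at h0
    obtain ⟨s, hs, hs0⟩ : ∃ s : ℤ, s * s = 1 ∧ 0 < s * δ ⟨0, by omega⟩ := by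
      rcases lt_or_gt_of_ne hne with h | h
      · exact ⟨-1, by norm_num, by linarith⟩
      · exact ⟨1, by norm_num, by linarith⟩
    refine ⟨s, hs, finRotate_induction hs0 fun i hi => ?_⟩
    have h1 : 0 < (s * δ i) * (s * δ (finRotate n i)) := by
      have : (s * δ i) * (s * δ (finRotate n i)) = δ i * δ (finRotate n i) := by
        linear_combination (δ i * δ (finRotate n i)) * hs
      rw [this]; exact hδδ i
    exact pos_of_mul_pos_right h1 hi.le
  have hs' : (s : ℝ) * s = 1 := by exact_mod_cast hs
  refine ⟨s, fun i => ((r i).1, s * (r i).2), hs, fun i => ?_, fun i => ?_, fun i j h1 h2 => ?_⟩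
  · rw [hr]
    refine Plane.ext (by simp) ?_
    simp only [toPlane_one]
    push_cast
    linear_combination -((r i).2 : ℝ) * hs'
  · have := hsδ i
    simp only [hδ, cross] at this ⊢
    linarith
  · have h3 : 0 < (s * δ i) * (s * e i j) := by
      have : (s * δ i) * (s * e i j) = δ i * e i j := by
        linear_combination (δ i * e i j) * hs
      rw [this]; exact hδe i j h1 h2
    have := pos_of_mul_pos_right h3 (hsδ i).le
    simp only [he, cross, Prod.fst_sub, Prod.snd_sub] at this ⊢
    linarith

/-- A point of the triangle with vertices `O`, `x`, `y` off the side `xy` is in the interior of a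
convex set containing `x` and `y` that has `O` in its interior. -/
theorem mem_interior_of_triangle {S : Set Plane} (hS : Convex ℝ S) {O x y z : Plane}
    (hO : O ∈ interior S) (hx : x ∈ S) (hy : y ∈ S) {α β : ℝ} (hα : 0 ≤ α) (hβ : 0 ≤ β)
    (hαβ : α + β < 1) (hz : z = (1 - α - β) • O + α • x + β • y) : z ∈ interior S := by
  rcases (add_nonneg hα hβ).lt_or_eq with h | h
  · have hw : (α / (α + β)) • x + (β / (α + β)) • y ∈ S :=
      hS hx hy (by positivity) (by positivity) (by field_simp)
    have := hS.combo_interior_self_mem_interior hO hw (a := 1 - α - β) (b := α + β)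
      (by linarith) h.le (by ring)
    rw [smul_add, smul_smul, smul_smul, mul_div_cancel₀ _ h.ne', mul_div_cancel₀ _ h.ne',
      ← add_assoc, ← hz] at this
    exact this
  · obtain rfl : α = 0 := by linarith
    obtain rfl : β = 0 := by linarith
    simpa [hz] using hO

/-- The only interior lattice point of a convex lattice polygon is at lattice distance one from
every side. -/
theorem Polygon.IsConvex.exists_isReflexive {n : ℕ} {M : Polygon Plane n} (hconv : M.IsConvex)
    (hlat : M.IsLattice) {O : Plane} (hO : M.inside ∩ latticePoints = {O}) :
    ∃ (s : ℤ) (v u : Fin n → ℤ × ℤ) (m : Fin n → ℕ), s * s = 1 ∧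
      (∀ i, M i = toPlane O s (v i)) ∧ IsReflexive v u m := by
  obtain ⟨hOi, hOl⟩ : O ∈ M.inside ∩ latticePoints := by rw [hO]; rfl
  obtain ⟨s, v, hs, hv, hpos, hside⟩ := hconv.exists_orientation hlat hOl hOi
  have hne : ∀ i, v (finRotate n i) - v i ≠ 0 := fun i h => by
    have := hpos i
    rw [sub_eq_zero.1 h] at this
    simp [cross, mul_comm] at this
  choose m u hm hu hprim using fun i => exists_eq_nsmul_primitive (hne i)
  have hsucc : ∀ i, v (finRotate n i) = v i + (m i : ℤ) • u i := fun i => by rw [← hu]; abel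
  have hm' : ∀ i, (0 : ℤ) < m i := fun i => by exact_mod_cast hm i
  have hcr : ∀ i, cross (v i) (u i) = 1 := by
    intro i
    refine cross_eq_one_of_empty_triangle (hm i) ?_ (hprim i) fun z α β hα hβ hαβ h1 h2 => ?_
    · have h1 := hpos i
      rw [hsucc] at h1
      have h2 : 0 < (m i : ℤ) * cross (v i) (u i) := by
        simp only [cross, Prod.fst_add, Prod.snd_add, Prod.smul_fst, Prod.smul_snd,
          smul_eq_mul] at h1 ⊢
        linarith
      exact pos_of_mul_pos_right h2 (hm' i).le
    · rw [← hsucc] at h1 h2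
      have hz : toPlane O s z ∈ M.inside := by
        refine mem_interior_of_triangle (convex_convexHull ℝ _) hOi
          (subset_convexHull ℝ _ ⟨i, rfl⟩) (subset_convexHull ℝ _ ⟨finRotate n i, rfl⟩)
          hα hβ hαβ ?_
        refine Plane.ext ?_ ?_
        · simp only [hv, PiLp.add_apply, PiLp.smul_apply, smul_eq_mul, toPlane_zero, h1]
          ring
        · simp only [hv, PiLp.add_apply, PiLp.smul_apply, smul_eq_mul, toPlane_one, h2]
          ring
      have : toPlane O s z ∈ M.inside ∩ latticePoints := ⟨hz, toPlane_mem_latticePoints hOl _ _⟩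
      rw [hO] at this
      refine toPlane_injective O hs (this.trans ?_)
      exact Plane.ext (by simp) (by simp)
  -- This turns strict convexity into `cross (v j) (u i) < 1` off side `i`.
  have hdist : ∀ i j, cross (v (finRotate n i) - v i) (v j - v i)
      = m i * (1 - cross (v j) (u i)) := by
    intro i j
    have h1 := hcr i
    rw [hu]
    simp only [cross, Prod.fst_sub, Prod.snd_sub, Prod.smul_fst, Prod.smul_snd,
      smul_eq_mul] at h1 ⊢
    linear_combination m i * h1
  have heq : ∀ i j, j = i ∨ j = finRotate n i → cross (v j) (u i) = 1 := by
    rintro i j (rfl | rfl)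
    · exact hcr _
    · have h1 := hcr i
      rw [hsucc]
      simp only [cross, Prod.fst_add, Prod.snd_add, Prod.smul_fst, Prod.smul_snd,
        smul_eq_mul] at h1 ⊢
      linear_combination h1
  have hlt : ∀ i j, ¬(j = i ∨ j = finRotate n i) → cross (v j) (u i) < 1 := by
    intro i j h
    push Not at h
    have h1 := hside i j h.1 h.2
    rw [hdist] at h1
    linarith [pos_of_mul_pos_right h1 (hm' i).le]
  refine ⟨s, v, u, m, hs, hv, hconv.three_le, hm, hsucc, fun i j => ?_, fun i j => ?_⟩
  · by_cases h : j = i ∨ j = finRotate n i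
    · exact (heq i j h).le
    · exact (hlt i j h).le
  · exact ⟨fun h1 => by_contra fun h => (hlt i j h).ne h1, heq i j⟩

/-! ### The dual polygon and the conclusion -/

/-- The lattice point nearest to `O` on a multiple of a primitive vector laid off from `O` is the
end of the primitive vector. -/
theorem isNearestLatticePoint_toPlane {O : Plane} (hO : O ∈ latticePoints) {s : ℤ}
    (hs : s * s = 1) {w u : ℤ × ℤ} (hwu : cross w u = 1) {m : ℕ} (hm : 0 < m) {V : Plane}
    (hV : V +ᵥ O = toPlane O s ((m : ℤ) • u)) : IsNearestLatticePoint O V (toPlane O s u) := by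
  have h0 : toPlane O s 0 = O := Plane.ext (by simp) (by simp)
  have hseg : ∀ z, toPlane O s z ∈ affineSegment ℝ O (V +ᵥ O) ↔
      ∃ k : ℕ, k ≤ m ∧ z = (k : ℤ) • u := fun z => by
    have := toPlane_mem_affineSegment_iff (O := O) hs (p := 0) (z := z) hwu m
    simpa only [zero_add, h0, ← hV] using this
  have hd : ∀ k : ℕ, dist O (toPlane O s ((k : ℤ) • u)) = k * dist O (toPlane O s u) := fun k => by
    have : O - toPlane O s ((k : ℤ) • u) = (k : ℝ) • (O - toPlane O s u) :=
      Plane.ext (by simp) (by simp; ring)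
    rw [dist_eq_norm, dist_eq_norm, this, norm_smul, Real.norm_natCast]
  refine ⟨(hseg u).2 ⟨1, hm, by simp⟩, toPlane_mem_latticePoints hO _ _, fun h => ?_,
    fun C hC hCl hCO => ?_⟩
  · rw [toPlane_injective O hs (h.trans h0.symm)] at hwu
    simp [cross] at hwu
  · obtain ⟨z, rfl⟩ := exists_eq_toPlane hO hCl hs
    obtain ⟨k, -, rfl⟩ := (hseg z).1 hC
    rw [hd]
    have hk : k ≠ 0 := by rintro rfl; simp [h0] at hCO
    have : (1 : ℝ) ≤ k := by exact_mod_cast Nat.one_le_iff_ne_zero.2 hk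
    exact le_mul_of_one_le_left dist_nonneg this

theorem mainTheorem1 {n : ℕ} (M : Polygon Plane n) (hconv : M.IsConvex) (hlat : M.IsLattice)
    (O : Plane) (hO : M.inside ∩ latticePoints = {O})
    (Mdual : Polygon Plane n) (hdual : M.IsDual O Mdual) :
    M.boundaryLatticePoints.encard + Mdual.boundaryLatticePoints.encard = 12 := by
  have hOl : O ∈ latticePoints := by
    have : O ∈ M.inside ∩ latticePoints := by rw [hO]; rfl
    exact this.2
  obtain ⟨s, v, u, m, hs, hv, h⟩ := hconv.exists_isReflexive hlat hO
  obtain ⟨a, hd⟩ := h.exists_dual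
  have hN : ∀ i, Mdual i = toPlane O s (u i) := by
    intro i
    have hV : (M (finRotate n i) -ᵥ M i) +ᵥ O = toPlane O s ((m i : ℤ) • u i) := by
      rw [hv, hv, h.succ]
      exact Plane.ext (by simp; ring) (by simp; ring)
    refine (existsUnique_isNearestLatticePoint hOl ?_ ?_).unique (hdual i)
      (isNearestLatticePoint_toPlane hOl hs (h.cross_self i) (h.pos i) hV)
    · rw [hV]; exact toPlane_mem_latticePoints hOl _ _
    · exact vsub_ne_zero.2 (hconv.nondegenerate i).symm
  rw [h.encard_boundaryLatticePoints hOl hs hv, hd.encard_boundaryLatticePoints hOl hs hN]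
  exact_mod_cast h.sum_add_sum_dual hd
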